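/- Let $d$ be a natural number and let $\mathbf{s}=(s_1,\ldots,s_d)$ be an increasing (i.e. $s_1\le s_2\le\cdots\le s_d$) sequence of positive integers such that for every $1\le i\le d-1$ there is a positive integer $k_i$ with $s_{i+1}=k_i s_i$. Then the $\mathbf{s}$-lecture hall polytope \[ \mathbf{P}_d^{(\mathbf{s})}=\left\{\mathbf{x}\in\mathbb{R}^d : 0\le \frac{x_1}{s_1}\le\frac{x_2}{s_2}\le\cdots\le\frac{x_d}{s_d}\le 1\right\} \] admits a unimodular triangulation. That is, there is a finite geometric simplicial complex whose underlying space is $\mathbf{P}_d^{(\mathbf{s})}$, all of whose maximal simplices are $d$-dimensional, and such that every maximal simplex is the image of the standard $d$-simplex $\operatorname{conv}(\mathbf{0},\mathbf{e}_1,\ldots,\mathbf{e}_d)$ under a map $\mathbf{x}\mapsto A\mathbf{x}+\mathbf{b}$ with $A\in GL_d(\mathbb{Z})$ and $\mathbf{b}\in\mathbb{Z}^d$. -/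

import Mathlib

/-- The `s`-lecture hall polytope
`{x ∈ ℝᵈ : 0 ≤ x₁/s₁ ≤ x₂/s₂ ≤ ⋯ ≤ x_d/s_d ≤ 1}`, with coordinates indexed by `Fin d`. -/
def lectureHallPolytope {d : ℕ} (s : Fin d → ℕ) : Set (Fin d → ℝ) :=
  {x | (∀ i, 0 ≤ x i / (s i : ℝ)) ∧ Monotone (fun i => x i / (s i : ℝ)) ∧
    ∀ i, x i / (s i : ℝ) ≤ 1}

/-- The standard `d`-simplex in `ℝᵈ`: the convex hull of the origin and the standard basis. -/
def standardSimplex (d : ℕ) : Set (Fin d → ℝ) :=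
  convexHull ℝ (insert 0 (Set.range fun i : Fin d => (Pi.single i 1 : Fin d → ℝ)))

/-- Two subsets of `ℝᵈ` are unimodularly equivalent if a map `x ↦ A x + b` with `A ∈ GL_d(ℤ)` and
`b ∈ ℤᵈ` carries the first onto the second. -/
def UnimodularlyEquivalent {d : ℕ} (P Q : Set (Fin d → ℝ)) : Prop :=
  ∃ (A : Matrix.GeneralLinearGroup (Fin d) ℤ) (b : Fin d → ℤ),
    (fun x : Fin d → ℝ =>
      Matrix.mulVec ((A : Matrix (Fin d) (Fin d) ℤ).map (fun z : ℤ => (z : ℝ))) x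
        + fun i => (b i : ℝ)) '' P = Q

/-- A (finite) simplicial complex `K` triangulates `P ⊆ ℝᵈ` if its simplices cover exactly `P` and
all its maximal simplices are `d`-dimensional. That the simplices meet face to face is part of
being a simplicial complex. -/
structure IsTriangulation {d : ℕ} (K : Geometry.SimplicialComplex ℝ (Fin d → ℝ))
    (P : Set (Fin d → ℝ)) : Prop where
  finite : K.faces.Finite
  space_eq : K.space = P
  card_facet : ∀ σ ∈ K.facets, σ.card = d + 1

/-- `P ⊆ ℝᵈ` admits a unimodular triangulation: it has a triangulation each of whose
`d`-dimensional simplices is unimodularly equivalent to the standard `d`-simplex. -/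
def AdmitsUnimodularTriangulation {d : ℕ} (P : Set (Fin d → ℝ)) : Prop :=
  ∃ K : Geometry.SimplicialComplex ℝ (Fin d → ℝ), IsTriangulation K P ∧
    ∀ σ ∈ K.facets,
      UnimodularlyEquivalent (standardSimplex d) (convexHull ℝ (σ : Set (Fin d → ℝ)))

/-!
The polytope `P_d` of `(s₁, …, s_d)` with `s_d = k s_{d-1}` is a *chimney* over the polytope
`P_{d-1}` of `(s₁, …, s_{d-1})`: it consists of the points `(x, h)` with `x ∈ P_{d-1}` and
`k x_{d-1} ≤ h ≤ s_d`. Divisibility makes both bounds integral affine functions, so it is enough to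
show that a unimodular triangulation of the base of such a chimney extends to the chimney
(`IsUnimodularFacetFamily.chimney`), and to induct on `d`.

Let `l ≤ u` be the bounds. Over a unimodular simplex `σ` of the base, the values of `l` at the
vertices are raised to those of `u` by steps of one, first at the first vertex of `σ`, then at the
second, and so on. Each step, which raises a vertex `p` from `j` to `j + 1`, sweeps out a lattice
simplex `chimneyFacet`, and this simplex is unimodular because its vertical edge has length one
(`exists_int_chimneyFacet`). Every height between the bounds is passed during some step
(`exists_crossing`, `exists_int_step`), so these simplices cover the chimney. If the order of the
vertices is chosen once for all lattice points, then the simplices over different `σ` fit together.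

Triangulations are handled through barycentric coordinates: simplices meet face to face if and only
if no point has two different systems of nonnegative coordinates supported on faces. For two
simplices of the chimney, the coordinates over the base agree by induction, and the heights reached
before and after a given staircase separate the simplices (`lift_eq_lift_of_le`).
-/

/-! ### Lattice triangulations through their facets -/

/-- A lattice point, seen in `ℝᵈ`. -/
def latticePoint {d : ℕ} (v : Fin d → ℤ) : Fin d → ℝ := fun i => (v i : ℝ)

/-- The lattice point `(1, v)` over `v`, seen in `ℝ × ℝᵈ`. A linear combination of such points
records the total weight and the weighted sum at once. -/
def homogenize {d : ℕ} (v : Fin d → ℤ) : ℝ × (Fin d → ℝ) := (1, latticePoint v)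

/-- A unimodular triangulation of `P`, given by the finite collection `𝓕` of the vertex sets of
its facets. The condition `exists_int` says that the points `(1, v)`, `v ∈ F`, generate `ℤ × ℤᵈ`.
The condition `unique` replaces both affine independence of each `F` and the requirement that
the simplices meet face to face: a point has at most one system of barycentric coordinates. -/
structure IsUnimodularFacetFamily {d : ℕ} (𝓕 : Finset (Finset (Fin d → ℤ)))
    (P : Set (Fin d → ℝ)) : Prop where
  card_eq : ∀ F ∈ 𝓕, F.card = d + 1
  exists_int : ∀ F ∈ 𝓕, ∀ z : Fin d → ℤ, ∃ c : (Fin d → ℤ) →₀ ℤ, c.support ⊆ F ∧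
    Finsupp.linearCombination ℤ (fun v : Fin d → ℤ => ((1 : ℤ), v)) c = (1, z)
  mem_iff : ∀ x, x ∈ P ↔ ∃ F ∈ 𝓕, ∃ W : (Fin d → ℤ) →₀ ℝ, 0 ≤ W ∧ W.support ⊆ F ∧
    Finsupp.linearCombination ℝ homogenize W = (1, x)
  unique : ∀ F ∈ 𝓕, ∀ F' ∈ 𝓕, ∀ W W' : (Fin d → ℤ) →₀ ℝ, 0 ≤ W → 0 ≤ W' →
    W.support ⊆ F → W'.support ⊆ F' →
    Finsupp.linearCombination ℝ homogenize W = Finsupp.linearCombination ℝ homogenize W' → W = W'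

theorem latticePoint_injective {d : ℕ} : Function.Injective (latticePoint (d := d)) := by
  intro v w h
  ext i
  exact Int.cast_injective (α := ℝ) (congrFun h i)

theorem mem_convexHull_latticePoint_iff {d : ℕ} (S : Finset (Fin d → ℤ)) (x : Fin d → ℝ) :
    x ∈ convexHull ℝ (latticePoint '' (S : Set (Fin d → ℤ))) ↔
      ∃ W : (Fin d → ℤ) →₀ ℝ, 0 ≤ W ∧ W.support ⊆ S ∧
        Finsupp.linearCombination ℝ homogenize W = (1, x) := by
  constructor
  · intro hx
    refine convexHull_min (t := {x | ∃ W : (Fin d → ℤ) →₀ ℝ, 0 ≤ W ∧ W.support ⊆ S ∧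
        Finsupp.linearCombination ℝ homogenize W = (1, x)}) ?_ ?_ hx
    · rintro _ ⟨v, hv, rfl⟩
      refine ⟨Finsupp.single v 1, by simp, ?_, by simp [homogenize]⟩
      exact Finsupp.support_single_subset.trans (by simpa using hv)
    · rintro y ⟨W, hW, hS, hy⟩ z ⟨W', hW', hS', hz⟩ a b ha hb hab
      refine ⟨a • W + b • W', add_nonneg (smul_nonneg ha hW) (smul_nonneg hb hW'), ?_, ?_⟩
      · classical
        exact Finsupp.support_add.trans (Finset.union_subset
          (Finsupp.support_smul.trans hS) (Finsupp.support_smul.trans hS'))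
      · simp [hy, hz, hab]
  · rintro ⟨W, hW, hS, hx⟩
    have h1 : ∑ v ∈ W.support, W v = 1 := by
      simpa [Finsupp.linearCombination_apply, Finsupp.sum, Prod.fst_sum, homogenize] using
        congrArg Prod.fst hx
    have h2 : ∑ v ∈ W.support, W v • latticePoint v = x := by
      simpa [Finsupp.linearCombination_apply, Finsupp.sum, Prod.snd_sum, homogenize] using
        congrArg Prod.snd hx
    rw [← h2]
    exact (convex_convexHull ℝ _).sum_mem (fun v _ => hW v) h1
      (fun v hv => subset_convexHull ℝ _ ⟨v, hS hv, rfl⟩)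

section Complex

variable {d : ℕ} {𝓕 : Finset (Finset (Fin d → ℤ))} {P : Set (Fin d → ℝ)}

theorem IsUnimodularFacetFamily.affineIndependent (h : IsUnimodularFacetFamily 𝓕 P)
    {F : Finset (Fin d → ℤ)} (hF : F ∈ 𝓕) :
    AffineIndependent ℝ (fun v : F => latticePoint (v : Fin d → ℤ)) := by
  rw [affineIndependent_iff]
  intro s w hw hp
  set W : (Fin d → ℤ) →₀ ℝ := ∑ e ∈ s, Finsupp.single (e : Fin d → ℤ) (w e) with hWdef
  have hval : ∀ e ∈ s, W e = w e := by
    intro e he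
    rw [hWdef, Finsupp.finsetSum_apply, Finset.sum_eq_single e]
    · simp
    · intro b _ hb
      exact Finsupp.single_eq_of_ne (fun h => hb (Subtype.ext h.symm))
    · exact fun h => absurd he h
  have hsupp : ∀ v, v ∉ F → W v = 0 := by
    intro v hv
    rw [hWdef, Finsupp.finsetSum_apply]
    exact Finset.sum_eq_zero fun b _ => Finsupp.single_eq_of_ne (fun h => hv (h ▸ b.2))
  have hlc : Finsupp.linearCombination ℝ homogenize W = 0 := by
    rw [hWdef, map_sum]
    simp only [Finsupp.linearCombination_single, homogenize, Prod.smul_mk, smul_eq_mul, mul_one]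
    ext1
    · simpa [Prod.fst_sum] using hw
    · simpa [Prod.snd_sum] using hp
  -- Positive and negative part of an affine relation represent the same point.
  have hpn : W⁺ = W⁻ := by
    refine h.unique F hF F hF _ _ (posPart_nonneg W) (negPart_nonneg W) ?_ ?_ ?_
    · intro v hv
      by_contra hvF
      rw [Finsupp.mem_support_iff] at hv
      exact hv (by simp [posPart_def, hsupp v hvF])
    · intro v hv
      by_contra hvF
      rw [Finsupp.mem_support_iff] at hv
      exact hv (by simp [negPart_def, hsupp v hvF])
    · rw [← sub_eq_zero, ← map_sub, posPart_sub_negPart, hlc]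
  have hW : W = 0 := by rw [← posPart_sub_negPart W, hpn, sub_self]
  intro e he
  rw [← hval e he, hW]
  rfl

/-- The geometric simplicial complex of all faces of the facets in `𝓕`. -/
noncomputable def IsUnimodularFacetFamily.complex (h : IsUnimodularFacetFamily 𝓕 P) :
    Geometry.SimplicialComplex ℝ (Fin d → ℝ) :=
  Geometry.SimplicialComplex.ofErase
    {s | ∃ F ∈ 𝓕, ∃ S ⊆ F, (s : Set (Fin d → ℝ)) = latticePoint '' (S : Set (Fin d → ℤ))}
    (by
      rintro s ⟨F, hF, S, hSF, hs⟩
      have h1 := (h.affineIndependent hF).range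
      have h2 : (s : Set (Fin d → ℝ)) ⊆
          Set.range (fun v : F => latticePoint (v : Fin d → ℤ)) := by
        rw [hs]
        rintro _ ⟨v, hv, rfl⟩
        exact ⟨⟨v, hSF hv⟩, rfl⟩
      exact h1.mono h2)
    (by
      classical
      rintro s t hts ⟨F, hF, S, hSF, hs⟩
      refine ⟨F, hF, S.filter (fun v => latticePoint v ∈ t),
        (Finset.filter_subset _ _).trans hSF, ?_⟩
      ext x
      constructor
      · intro hx
        have hxs : x ∈ (s : Set (Fin d → ℝ)) := hts hx
        rw [hs] at hxs
        obtain ⟨v, hv, rfl⟩ := hxs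
        exact ⟨v, by simpa using ⟨hv, hx⟩, rfl⟩
      · rintro ⟨v, hv, rfl⟩
        simp only [Finset.coe_filter, Set.mem_ofPred_eq] at hv
        exact hv.2)
    (by
      classical
      rintro s ⟨F, hF, S, hSF, hs⟩ t ⟨F', hF', T, hTF, ht⟩ x ⟨hxs, hxt⟩
      rw [hs, mem_convexHull_latticePoint_iff] at hxs
      rw [ht, mem_convexHull_latticePoint_iff] at hxt
      obtain ⟨W, hW, hWS, hWx⟩ := hxs
      obtain ⟨W', hW', hWT, hWx'⟩ := hxt
      obtain rfl := h.unique F hF F' hF' W W' hW hW' (hWS.trans hSF) (hWT.trans hTF)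
        (hWx.trans hWx'.symm)
      have := (mem_convexHull_latticePoint_iff (S ∩ T) x).2
        ⟨W, hW, Finset.subset_inter hWS hWT, hWx⟩
      refine convexHull_mono ?_ this
      rw [hs, ht]
      rintro _ ⟨v, hv, rfl⟩
      simp only [Finset.coe_inter] at hv
      exact ⟨⟨v, hv.1, rfl⟩, ⟨v, hv.2, rfl⟩⟩)

theorem IsUnimodularFacetFamily.mem_complex_faces (h : IsUnimodularFacetFamily 𝓕 P)
    {s : Finset (Fin d → ℝ)} :
    s ∈ h.complex.faces ↔ (∃ F ∈ 𝓕, ∃ S ⊆ F,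
      (s : Set (Fin d → ℝ)) = latticePoint '' (S : Set (Fin d → ℤ))) ∧ s ≠ ∅ :=
  Iff.rfl

theorem IsUnimodularFacetFamily.image_mem_faces (h : IsUnimodularFacetFamily 𝓕 P)
    {F : Finset (Fin d → ℤ)} (hF : F ∈ 𝓕) :
    F.map ⟨latticePoint, latticePoint_injective⟩ ∈ h.complex.faces := by
  refine h.mem_complex_faces.2 ⟨⟨F, hF, F, subset_rfl, by simp⟩, ?_⟩
  rw [← Finset.card_pos.trans Finset.nonempty_iff_ne_empty, Finset.card_map, h.card_eq F hF]
  omega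

theorem IsUnimodularFacetFamily.exists_of_mem_facets (h : IsUnimodularFacetFamily 𝓕 P)
    {σ : Finset (Fin d → ℝ)} (hσ : σ ∈ h.complex.facets) :
    ∃ F ∈ 𝓕, σ = F.map ⟨latticePoint, latticePoint_injective⟩ := by
  obtain ⟨⟨F, hF, S, hSF, hS⟩, -⟩ := h.mem_complex_faces.1 hσ.1
  refine ⟨F, hF, hσ.2 (h.image_mem_faces hF) ?_⟩
  rw [← Finset.coe_subset, hS]
  simpa using Set.image_mono (f := latticePoint) hSF

theorem IsUnimodularFacetFamily.isTriangulation (h : IsUnimodularFacetFamily 𝓕 P) :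
    IsTriangulation h.complex P where
  finite := by
    classical
    refine Set.Finite.subset (Set.Finite.biUnion 𝓕.finite_toSet (fun F _ =>
      (F.map ⟨latticePoint, latticePoint_injective⟩).powerset.finite_toSet)) ?_
    intro s hs
    obtain ⟨⟨F, hF, S, hSF, hS⟩, -⟩ := h.mem_complex_faces.1 hs
    refine Set.mem_biUnion hF ?_
    rw [Finset.mem_coe, Finset.mem_powerset, ← Finset.coe_subset, hS]
    simpa using Set.image_mono (f := latticePoint) hSF
  space_eq := by
    ext x
    rw [Geometry.SimplicialComplex.mem_space_iff, h.mem_iff]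
    constructor
    · rintro ⟨s, hs, hx⟩
      obtain ⟨⟨F, hF, S, hSF, hS⟩, -⟩ := h.mem_complex_faces.1 hs
      rw [hS, mem_convexHull_latticePoint_iff] at hx
      obtain ⟨W, hW, hWS, hx⟩ := hx
      exact ⟨F, hF, W, hW, hWS.trans hSF, hx⟩
    · rintro ⟨F, hF, hW⟩
      refine ⟨_, h.image_mem_faces hF, ?_⟩
      simpa using (mem_convexHull_latticePoint_iff F x).2 hW
  card_facet := by
    intro σ hσ
    obtain ⟨F, hF, rfl⟩ := h.exists_of_mem_facets hσ
    rw [Finset.card_map, h.card_eq F hF]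

/-- If the points `(1, v)`, `v ∈ F`, generate `ℤ × ℤᵈ` and `F` has `d + 1` elements, then the
differences to one of the vertices are a basis of `ℤᵈ`. -/
theorem unimodularlyEquivalent_of_exists_int {F : Finset (Fin d → ℤ)} (hcard : F.card = d + 1)
    (hint : ∀ z : Fin d → ℤ, ∃ c : (Fin d → ℤ) →₀ ℤ, c.support ⊆ F ∧
      Finsupp.linearCombination ℤ (fun v : Fin d → ℤ => ((1 : ℤ), v)) c = (1, z)) :
    UnimodularlyEquivalent (standardSimplex d)
      (convexHull ℝ (latticePoint '' (F : Set (Fin d → ℤ)))) := by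
  classical
  let e : Fin (d + 1) ≃ F := (Finset.equivFinOfCardEq hcard).symm
  let M : Matrix (Fin d) (Fin d) ℤ := Matrix.of fun i j => (e j.succ).1 i - (e 0).1 i
  have hsurj : Function.Surjective M.mulVec := by
    intro z
    obtain ⟨c, hc, hz⟩ := hint (z + (e 0).1)
    have hsum : ∀ {G : Type} [AddCommGroup G] (g : (Fin d → ℤ) → G),
        Finsupp.linearCombination ℤ g c =
          c (e 0).1 • g (e 0).1 + ∑ j : Fin d, c (e j.succ).1 • g (e j.succ).1 := by
      intro G _ g
      rw [Finsupp.linearCombination_apply, Finsupp.sum_of_support_subset c hc _ (by simp),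
        ← Finset.sum_coe_sort F, ← e.sum_comp, Fin.sum_univ_succ]
    rw [hsum] at hz
    have h1 := congrArg Prod.fst hz
    have h2 := congrArg Prod.snd hz
    simp only [Prod.fst_add, Prod.snd_add, Prod.fst_sum, Prod.snd_sum, Prod.smul_mk,
      smul_eq_mul, mul_one] at h1 h2
    refine ⟨fun j => c (e j.succ).1, ?_⟩
    ext i
    have h3 := congrFun h2 i
    simp only [Pi.add_apply, Finset.sum_apply, Pi.smul_apply, smul_eq_mul] at h3
    simp only [Matrix.mulVec, dotProduct, M, Matrix.of_apply, sub_mul, Finset.sum_sub_distrib,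
      ← Finset.mul_sum]
    have h4 : ∑ j : Fin d, (e j.succ).1 i * c (e j.succ).1
        = ∑ j : Fin d, c (e j.succ).1 * (e j.succ).1 i :=
      Finset.sum_congr rfl fun j _ => mul_comm _ _
    rw [h4]
    linear_combination h3 - (e 0).1 i * h1
  obtain ⟨A, hA⟩ := Matrix.mulVec_surjective_iff_isUnit.1 hsurj
  refine ⟨A, (e 0).1, ?_⟩
  let f : (Fin d → ℝ) →ᵃ[ℝ] (Fin d → ℝ) :=
    (Matrix.mulVecLin (M.map (fun z : ℤ => (z : ℝ)))).toAffineMap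
      + AffineMap.const ℝ _ (latticePoint (e 0).1)
  have hf : (fun x : Fin d → ℝ => Matrix.mulVec
      ((A : Matrix (Fin d) (Fin d) ℤ).map (fun z : ℤ => (z : ℝ))) x
        + fun i => (((e 0).1 i : ℤ) : ℝ)) = f := by
    rw [hA]
    rfl
  rw [hf, standardSimplex, AffineMap.image_convexHull, Set.image_insert_eq, ← Set.range_comp]
  congr 1
  have h0 : f 0 = latticePoint (e 0).1 := by simp [f]
  have hj : ∀ j : Fin d, f (Pi.single j 1) = latticePoint (e j.succ).1 := by
    intro j
    ext i
    simp [f, latticePoint, M]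
  have hF : (F : Set (Fin d → ℤ)) = Set.range (fun k => (e k).1) := by
    ext v
    constructor
    · intro hv
      exact ⟨e.symm ⟨v, hv⟩, by simp⟩
    · rintro ⟨k, rfl⟩
      exact (e k).2
  rw [h0, hF, ← Set.range_comp]
  ext x
  simp only [Set.mem_insert_iff, Set.mem_range, Function.comp_apply, hj, Fin.exists_fin_succ,
    eq_comm]

theorem IsUnimodularFacetFamily.admitsUnimodularTriangulation
    (h : IsUnimodularFacetFamily 𝓕 P) : AdmitsUnimodularTriangulation P := by
  refine ⟨h.complex, h.isTriangulation, ?_⟩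
  intro σ hσ
  obtain ⟨F, hF, rfl⟩ := h.exists_of_mem_facets hσ
  simpa using unimodularlyEquivalent_of_exists_int (h.card_eq F hF) (h.exists_int F hF)

end Complex

/-! ### Crossing a staircase -/

/-- Raise the values on `σ` from `l` to `u` one element at a time, in the order given by `f`. A
height between the total weighted values is passed while some element with `l p < u p` is being
raised. -/
theorem exists_crossing {α β : Type*} [LinearOrder β] (f : α → β)
    (σ : Finset α) (w l u : α → ℝ) (h : ℝ)
    (hlu : ∀ v ∈ σ, l v ≤ u v) (hne : ∃ v ∈ σ, l v < u v)
    (hl : ∑ v ∈ σ, w v * l v ≤ h) (hu : h ≤ ∑ v ∈ σ, w v * u v) :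
    ∃ p ∈ σ, l p < u p ∧ ∑ v ∈ σ, w v * (if f v < f p then u v else l v) ≤ h ∧
      h ≤ ∑ v ∈ σ, w v * (if f v ≤ f p then u v else l v) := by
  classical
  -- An element between two consecutive non-degenerate ones does not contribute.
  have hdeg : ∀ v ∈ σ, ¬ l v < u v → l v = u v := fun v hv h => (hlu v hv).antisymm (not_lt.1 h)
  set S := σ.filter fun p => l p < u p ∧
    ∑ v ∈ σ, w v * (if f v < f p then u v else l v) ≤ h with hS
  have hSne : S.Nonempty := by
    obtain ⟨v₀, hv₀, hlt⟩ := hne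
    obtain ⟨p, hp, hmin⟩ := (σ.filter fun p => l p < u p).exists_min_image f
      ⟨v₀, Finset.mem_filter.2 ⟨hv₀, hlt⟩⟩
    rw [Finset.mem_filter] at hp
    refine ⟨p, Finset.mem_filter.2 ⟨hp.1, hp.2, le_of_eq_of_le (Finset.sum_congr rfl ?_) hl⟩⟩
    intro v hv
    split_ifs with hvp
    · rw [hdeg v hv fun hlt => (hmin v (Finset.mem_filter.2 ⟨hv, hlt⟩)).not_gt hvp]
    · rfl
  obtain ⟨p, hp, hmax⟩ := S.exists_max_image f hSne
  rw [hS, Finset.mem_filter] at hp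
  refine ⟨p, hp.1, hp.2.1, hp.2.2, ?_⟩
  by_contra! hlt
  by_cases hq : ∃ q ∈ σ, l q < u q ∧ f p < f q
  · obtain ⟨q₀, hq₀, hq₀'⟩ := hq
    obtain ⟨q, hq, hmin⟩ := (σ.filter fun q => l q < u q ∧ f p < f q).exists_min_image f
      ⟨q₀, Finset.mem_filter.2 ⟨hq₀, hq₀'⟩⟩
    rw [Finset.mem_filter] at hq
    refine (hmax q (Finset.mem_filter.2 ⟨hq.1, hq.2.1, le_of_eq_of_le ?_ hlt.le⟩)).not_gt hq.2.2
    refine Finset.sum_congr rfl fun v hv => ?_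
    by_cases hvp : f v ≤ f p
    · rw [if_pos hvp, if_pos (hvp.trans_lt hq.2.2)]
    · rw [if_neg hvp]
      split_ifs with hvq
      · rw [hdeg v hv fun hlt =>
          (hmin v (Finset.mem_filter.2 ⟨hv, hlt, not_le.1 hvp⟩)).not_gt hvq]
      · rfl
  · refine (hu.trans (le_of_eq (Finset.sum_congr rfl fun v hv => ?_))).not_gt hlt
    split_ifs with hvp
    · rfl
    · rw [hdeg v hv fun hlt => hq ⟨v, hv, hlt, not_le.1 hvp⟩]

theorem exists_int_step {w t : ℝ} {l u : ℤ} (hlu : l < u) (h1 : w * l ≤ t) (h2 : t ≤ w * u) :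
    ∃ j : ℤ, l ≤ j ∧ j < u ∧ w * j ≤ t ∧ t ≤ w * (j + 1) := by
  revert h2
  induction u, (Int.add_one_le_iff.2 hlu) using Int.leInduction with
  | base => exact fun h2 => ⟨l, le_rfl, by omega, h1, by exact_mod_cast h2⟩
  | succ u hu ih =>
    intro h2
    rcases le_total t (w * u) with h | h
    · obtain ⟨j, hj⟩ := ih (by omega) h
      exact ⟨j, hj.1, by omega, hj.2.2⟩
    · exact ⟨u, by omega, by omega, h, by exact_mod_cast h2⟩

/-! ### Triangulating a chimney -/

section Chimney

variable {n : ℕ} {β : Type*} [LinearOrder β]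

/-- The point over `v` on the graph of the height function `a`. -/
def graphPoint (a : (Fin n → ℤ) → ℤ) (v : Fin n → ℤ) : Fin (n + 1) → ℤ :=
  Fin.snoc (α := fun _ => ℤ) v (a v)

/-- The height function of a monotone staircase from `l` to `u`: the vertices before `p` in the
order given by `f` have been raised to `u`, and `p` to `j`. -/
def stair (f : (Fin n → ℤ) → β) (l u : (Fin n → ℤ) → ℤ) (p : Fin n → ℤ) (j : ℤ)
    (v : Fin n → ℤ) : ℤ :=
  if f v < f p then u v else if v = p then j else l v

/-- The simplex over `σ` swept out when a staircase raises the vertex `p` from `j` to `j + 1`. -/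
noncomputable def chimneyFacet (f : (Fin n → ℤ) → β) (l u : (Fin n → ℤ) → ℤ)
    (σ : Finset (Fin n → ℤ)) (p : Fin n → ℤ) (j : ℤ) : Finset (Fin (n + 1) → ℤ) :=
  insert (Fin.snoc (α := fun _ => ℤ) p (j + 1)) (σ.image (graphPoint (stair f l u p j)))

/-- The facets of the staircase triangulation of the chimney between `l` and `u`. -/
noncomputable def chimneyFacets (f : (Fin n → ℤ) → β) (l u : (Fin n → ℤ) → ℤ)
    (𝓕 : Finset (Finset (Fin n → ℤ))) :
    Finset (Finset (Fin (n + 1) → ℤ)) :=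
  𝓕.biUnion fun σ => σ.biUnion fun p => (Finset.Ico (l p) (u p)).image (chimneyFacet f l u σ p)

theorem mem_chimneyFacets {f : (Fin n → ℤ) → β} {l u : (Fin n → ℤ) → ℤ}
    {𝓕 : Finset (Finset (Fin n → ℤ))}
    {F : Finset (Fin (n + 1) → ℤ)} :
    F ∈ chimneyFacets f l u 𝓕 ↔ ∃ σ ∈ 𝓕, ∃ p ∈ σ, ∃ j, (l p ≤ j ∧ j < u p) ∧
      chimneyFacet f l u σ p j = F := by
  simp [chimneyFacets]

@[simp] theorem init_graphPoint (a : (Fin n → ℤ) → ℤ) (v : Fin n → ℤ) :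
    Fin.init (graphPoint a v) = v := Fin.init_snoc (α := fun _ => ℤ) _ _

@[simp] theorem graphPoint_last (a : (Fin n → ℤ) → ℤ) (v : Fin n → ℤ) :
    graphPoint a v (Fin.last n) = a v := Fin.snoc_last (α := fun _ => ℤ) _ _

theorem graphPoint_injective (a : (Fin n → ℤ) → ℤ) : Function.Injective (graphPoint a) :=
  Function.LeftInverse.injective (g := Fin.init (α := fun _ => ℤ)) (init_graphPoint a)

@[simp] theorem stair_self (f : (Fin n → ℤ) → β) (l u : (Fin n → ℤ) → ℤ)
    (p : Fin n → ℤ) (j : ℤ) :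
    stair f l u p j p = j := by simp [stair]

theorem card_chimneyFacet (f : (Fin n → ℤ) → β) (l u : (Fin n → ℤ) → ℤ)
    (σ : Finset (Fin n → ℤ)) (p : Fin n → ℤ)
    (j : ℤ) : (chimneyFacet f l u σ p j).card = σ.card + 1 := by
  rw [chimneyFacet, Finset.card_insert_of_notMem,
    Finset.card_image_of_injective _ (graphPoint_injective _)]
  intro h
  obtain ⟨v, -, hv⟩ := Finset.mem_image.1 h
  have h1 : v = p := by simpa using congrArg (Fin.init (α := fun _ => ℤ)) hv
  have h2 := congrFun hv (Fin.last n)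
  subst h1
  simp at h2

theorem linearCombination_homogenize_mapDomain_init (W : (Fin (n + 1) → ℤ) →₀ ℝ) :
    Finsupp.linearCombination ℝ homogenize (W.mapDomain (Fin.init (α := fun _ => ℤ))) =
      ((Finsupp.linearCombination ℝ homogenize W).1,
        Fin.init (α := fun _ => ℝ) (Finsupp.linearCombination ℝ homogenize W).2) := by
  rw [Finsupp.linearCombination_mapDomain]
  simp only [Finsupp.linearCombination_apply, Finsupp.sum]
  ext i
  · simp [Prod.fst_sum, homogenize]
  · simp [Prod.snd_sum, homogenize, latticePoint, Fin.init]

theorem linearCombination_last (W : (Fin (n + 1) → ℤ) →₀ ℝ) :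
    Finsupp.linearCombination ℝ (fun v : Fin (n + 1) → ℤ => (v (Fin.last n) : ℝ)) W =
      (Finsupp.linearCombination ℝ homogenize W).2 (Fin.last n) := by
  simp [Finsupp.linearCombination_apply, Finsupp.sum, Prod.snd_sum, homogenize, latticePoint]

theorem linearCombination_graphPoint (a : (Fin n → ℤ) → ℤ) (c : (Fin n → ℤ) →₀ ℤ) :
    Finsupp.linearCombination ℤ (fun v : Fin (n + 1) → ℤ => ((1 : ℤ), v))
        (c.mapDomain (graphPoint a)) =
      ((Finsupp.linearCombination ℤ (fun v : Fin n → ℤ => ((1 : ℤ), v)) c).1,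
        Fin.snoc (α := fun _ => ℤ)
          (Finsupp.linearCombination ℤ (fun v : Fin n → ℤ => ((1 : ℤ), v)) c).2
          (Finsupp.linearCombination ℤ a c)) := by
  rw [Finsupp.linearCombination_mapDomain]
  simp only [Finsupp.linearCombination_apply, Finsupp.sum]
  ext i
  · simp [Prod.fst_sum]
  · induction i using Fin.lastCases <;> simp [Prod.snd_sum, graphPoint]

theorem exists_int_chimneyFacet (f : (Fin n → ℤ) → β) (l u : (Fin n → ℤ) → ℤ)
    {σ : Finset (Fin n → ℤ)}
    {p : Fin n → ℤ} (hp : p ∈ σ) (j : ℤ)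
    (hint : ∀ z : Fin n → ℤ, ∃ c : (Fin n → ℤ) →₀ ℤ, c.support ⊆ σ ∧
      Finsupp.linearCombination ℤ (fun v : Fin n → ℤ => ((1 : ℤ), v)) c = (1, z))
    (z : Fin (n + 1) → ℤ) :
    ∃ c : (Fin (n + 1) → ℤ) →₀ ℤ, c.support ⊆ chimneyFacet f l u σ p j ∧
      Finsupp.linearCombination ℤ (fun v : Fin (n + 1) → ℤ => ((1 : ℤ), v)) c = (1, z) := by
  obtain ⟨c, hc, hz⟩ := hint (Fin.init z)
  -- Correct the height of the lift of `c` along the vertical edge over `p`.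
  set m : ℤ := z (Fin.last n) - Finsupp.linearCombination ℤ (stair f l u p j) c with hm
  have hsingle : ∀ q ∈ chimneyFacet f l u σ p j,
      (Finsupp.single q m).support ⊆ chimneyFacet f l u σ p j := fun q hq =>
    Finsupp.support_single_subset.trans (Finset.singleton_subset_iff.2 hq)
  refine ⟨c.mapDomain (graphPoint (stair f l u p j)) +
    (Finsupp.single (Fin.snoc (α := fun _ => ℤ) p (j + 1)) m -
      Finsupp.single (graphPoint (stair f l u p j) p) m), ?_, ?_⟩
  · refine Finsupp.support_add.trans (Finset.union_subset ?_
      (Finsupp.support_sub.trans (Finset.union_subset (hsingle _ ?_) (hsingle _ ?_))))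
    · exact Finsupp.mapDomain_support.trans
        ((Finset.image_subset_image hc).trans (Finset.subset_insert _ _))
    · exact Finset.mem_insert_self _ _
    · exact Finset.mem_insert_of_mem (Finset.mem_image_of_mem _ hp)
  · rw [map_add, map_sub, linearCombination_graphPoint, hz]
    simp only [Finsupp.linearCombination_single]
    ext i
    · simp
    · induction i using Fin.lastCases <;> simp [graphPoint, Fin.init, hm]
      ring

theorem Finsupp.mapDomain_nonneg_real {α β : Type*} (f : α → β) {w : α →₀ ℝ} (hw : 0 ≤ w) :
    0 ≤ w.mapDomain f :=
  Finset.sum_nonneg fun v _ => Finsupp.single_nonneg.2 (hw v)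

/-- Weights on a chimney facet: weights `w` on the lower graph and a weight `θ` on the apex. -/
theorem exists_decomposition_of_support_subset {f : (Fin n → ℤ) → β} {l u : (Fin n → ℤ) → ℤ}
    {σ : Finset (Fin n → ℤ)}
    {p : Fin n → ℤ} {j : ℤ} {W : (Fin (n + 1) → ℤ) →₀ ℝ} (hW : 0 ≤ W)
    (hsupp : W.support ⊆ chimneyFacet f l u σ p j) :
    ∃ (w : (Fin n → ℤ) →₀ ℝ) (θ : ℝ), 0 ≤ w ∧ 0 ≤ θ ∧ w.support ⊆ σ ∧
      W = w.mapDomain (graphPoint (stair f l u p j)) +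
        Finsupp.single (Fin.snoc (α := fun _ => ℤ) p (j + 1)) θ := by
  classical
  set y : Fin (n + 1) → ℤ := Fin.snoc (α := fun _ => ℤ) p (j + 1) with hy
  have hgraph : ∀ q ∈ (W.erase y).support, q ∈ σ.image (graphPoint (stair f l u p j)) := by
    intro q hq
    rw [Finsupp.support_erase, Finset.mem_erase] at hq
    exact (Finset.mem_insert.1 (hsupp hq.2)).resolve_left hq.1
  refine ⟨(W.erase y).mapDomain (Fin.init (α := fun _ => ℤ)), W y,
    Finsupp.mapDomain_nonneg_real _ ?_, hW y, ?_, ?_⟩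
  · intro q
    rw [Finsupp.erase_apply]
    split_ifs
    · exact le_rfl
    · exact hW q
  · refine Finsupp.mapDomain_support.trans fun v hv => ?_
    obtain ⟨q, hq, rfl⟩ := Finset.mem_image.1 hv
    obtain ⟨v, hv, rfl⟩ := Finset.mem_image.1 (hgraph q hq)
    rwa [init_graphPoint]
  · rw [← Finsupp.mapDomain_comp]
    conv_lhs => rw [← Finsupp.erase_add_single y W]
    congr 1
    conv_lhs => rw [← Finsupp.mapDomain_id (v := W.erase y)]
    refine Finsupp.mapDomain_congr fun q hq => ?_
    obtain ⟨v, hv, rfl⟩ := Finset.mem_image.1 (hgraph q hq)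
    simp

theorem mapDomain_init_lift (a : (Fin n → ℤ) → ℤ) (w : (Fin n → ℤ) →₀ ℝ) (p : Fin n → ℤ)
    (m : ℤ) (θ : ℝ) :
    (w.mapDomain (graphPoint a) +
        Finsupp.single (Fin.snoc (α := fun _ => ℤ) p m) θ).mapDomain
      (Fin.init (α := fun _ => ℤ)) = w + Finsupp.single p θ := by
  rw [Finsupp.mapDomain_add, Finsupp.mapDomain_single, ← Finsupp.mapDomain_comp,
    Fin.init_snoc (α := fun _ => ℤ)]
  congr 1
  have : Fin.init (α := fun _ => ℤ) ∘ graphPoint a = id := funext fun v => init_graphPoint a v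
  rw [this, Finsupp.mapDomain_id]

theorem linearCombination_last_lift (a : (Fin n → ℤ) → ℤ) (w : (Fin n → ℤ) →₀ ℝ)
    (p : Fin n → ℤ) (m : ℤ) (θ : ℝ) :
    Finsupp.linearCombination ℝ (fun v : Fin (n + 1) → ℤ => (v (Fin.last n) : ℝ))
      (w.mapDomain (graphPoint a) + Finsupp.single (Fin.snoc (α := fun _ => ℤ) p m) θ) =
    Finsupp.linearCombination ℝ (fun v => (a v : ℝ)) w + θ * m := by
  rw [map_add, Finsupp.linearCombination_mapDomain, Finsupp.linearCombination_single]
  congr 1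
  · congr 2
    ext v
    simp
  · simp

/-- If the staircase step `(a, p)` comes before the step `(b, p')`, then points of the two simplices
over the same base point have heights separated by `b`; if the heights agree, both points lie on the
graph of `b`, where the weights are determined by the base. -/
theorem lift_eq_lift_of_le {a b : (Fin n → ℤ) → ℤ} {w w' : (Fin n → ℤ) →₀ ℝ}
    {p p' : Fin n → ℤ} {θ θ' : ℝ} (hw : 0 ≤ w) (hθ : 0 ≤ θ) (hθ' : 0 ≤ θ')
    (hab : ∀ v ∈ w.support, a v ≤ b v) (hp : a p + 1 ≤ b p)
    (hbase : w + Finsupp.single p θ = w' + Finsupp.single p' θ')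
    (hheight : Finsupp.linearCombination ℝ (fun v => (a v : ℝ)) w + θ * (a p + 1 : ℤ) =
      Finsupp.linearCombination ℝ (fun v => (b v : ℝ)) w' + θ' * (b p' + 1 : ℤ)) :
    w.mapDomain (graphPoint a) + Finsupp.single (Fin.snoc (α := fun _ => ℤ) p (a p + 1)) θ =
      w'.mapDomain (graphPoint b) +
        Finsupp.single (Fin.snoc (α := fun _ => ℤ) p' (b p' + 1)) θ' := by
  have hb := congrArg (Finsupp.linearCombination ℝ (fun v => (b v : ℝ))) hbase
  simp only [map_add, Finsupp.linearCombination_single, smul_eq_mul] at hb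
  have hdiff : Finsupp.linearCombination ℝ (fun v => (b v : ℝ)) w -
      Finsupp.linearCombination ℝ (fun v => (a v : ℝ)) w =
      ∑ v ∈ w.support, w v * ((b v : ℝ) - a v) := by
    simp [Finsupp.linearCombination_apply, Finsupp.sum, mul_sub]
  have hterm : ∀ v ∈ w.support, 0 ≤ w v * ((b v : ℝ) - a v) := fun v hv =>
    mul_nonneg (hw v) (sub_nonneg.2 (by exact_mod_cast hab v hv))
  have hsum := Finset.sum_nonneg hterm
  have hp' : (0 : ℝ) ≤ b p - (a p + 1) := sub_nonneg.2 (by exact_mod_cast hp)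
  have hθp := mul_nonneg hθ hp'
  push_cast at hheight
  have hkey : ∑ v ∈ w.support, w v * ((b v : ℝ) - a v) + θ * (b p - (a p + 1)) + θ' = 0 := by
    linear_combination hb - hdiff - hheight
  have h1 : θ' = 0 := by linarith
  have h2 : θ * (b p - (a p + 1)) = 0 := by linarith
  have h3 : ∑ v ∈ w.support, w v * ((b v : ℝ) - a v) = 0 := by linarith
  rw [Finset.sum_eq_zero_iff_of_nonneg hterm] at h3
  have h4 : w.mapDomain (graphPoint a) = w.mapDomain (graphPoint b) := by
    refine Finsupp.mapDomain_congr fun v hv => ?_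
    have h5 := (mul_eq_zero.1 (h3 v hv)).resolve_left (Finsupp.mem_support_iff.1 hv)
    have h6 : b v = a v := by exact_mod_cast sub_eq_zero.1 h5
    rw [graphPoint, graphPoint, h6]
  have h7 : Finsupp.single (Fin.snoc (α := fun _ => ℤ) p (a p + 1) : Fin (n + 1) → ℤ) θ =
      Finsupp.single (graphPoint b p) θ := by
    rcases mul_eq_zero.1 h2 with h | h
    · simp [h]
    · have h8 : b p = a p + 1 := by exact_mod_cast sub_eq_zero.1 h
      rw [graphPoint, h8]
  rw [h4, h7, h1, Finsupp.single_zero, add_zero, ← Finsupp.mapDomain_single,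
    ← Finsupp.mapDomain_add, hbase, h1, Finsupp.single_zero, add_zero]

theorem stair_le_stair {f : (Fin n → ℤ) → β} {l u : (Fin n → ℤ) → ℤ}
    {p p' : Fin n → ℤ} {j j' : ℤ}
    (hj : j < u p) (hj' : l p' ≤ j') (h : f p < f p' ∨ p = p' ∧ j < j')
    {v : Fin n → ℤ} (hv : l v ≤ u v) : stair f l u p j v ≤ stair f l u p' j' v := by
  unfold stair
  rcases h with h | ⟨rfl, h⟩
  · by_cases h1 : f v < f p
    · rw [if_pos h1, if_pos (h1.trans h)]
    · rw [if_neg h1]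
      by_cases h2 : v = p
      · subst h2
        rw [if_pos rfl, if_pos h]
        exact hj.le
      · rw [if_neg h2]
        split_ifs with h3 h4
        · exact hv
        · exact h4 ▸ hj'
        · exact le_rfl
  · split_ifs
    · exact le_rfl
    · exact h.le
    · exact le_rfl

theorem add_one_le_stair {f : (Fin n → ℤ) → β} {l u : (Fin n → ℤ) → ℤ}
    {p p' : Fin n → ℤ} {j j' : ℤ}
    (hj : j < u p) (h : f p < f p' ∨ p = p' ∧ j < j') :
    j + 1 ≤ stair f l u p' j' p := by
  rcases h with h | ⟨rfl, h⟩
  · rw [stair, if_pos h]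
    omega
  · rw [stair_self]
    omega

/-- Staircases extend a unimodular triangulation of `P` to one of the chimney
`{(x, h) : x ∈ P, L x ≤ h ≤ U x}`, if `L` and `U` are integral affine functions with `L ≤ U` on `P`.
Affine functions on `ℝⁿ` are written as linear functions of `(1, x)`. -/
theorem IsUnimodularFacetFamily.chimney {𝓕 : Finset (Finset (Fin n → ℤ))}
    {P : Set (Fin n → ℝ)} (h : IsUnimodularFacetFamily 𝓕 P)
    {f : (Fin n → ℤ) → β} (hf : Function.Injective f)
    (l u : ℤ × (Fin n → ℤ) →ₗ[ℤ] ℤ) (L U : ℝ × (Fin n → ℝ) →ₗ[ℝ] ℝ)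
    (hL : ∀ v, L (homogenize v) = l (1, v)) (hU : ∀ v, U (homogenize v) = u (1, v))
    (hLU : ∀ x ∈ P, L (1, x) ≤ U (1, x)) (hne : ∃ z, l (1, z) ≠ u (1, z)) :
    IsUnimodularFacetFamily (chimneyFacets f (fun v => l (1, v)) (fun v => u (1, v)) 𝓕)
      {x : Fin (n + 1) → ℝ | Fin.init x ∈ P ∧ L (1, Fin.init x) ≤ x (Fin.last n) ∧
        x (Fin.last n) ≤ U (1, Fin.init x)} := by
  set l' : (Fin n → ℤ) → ℤ := fun v => l (1, v) with hl'
  set u' : (Fin n → ℤ) → ℤ := fun v => u (1, v) with hu'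
  have hlL : ∀ w : (Fin n → ℤ) →₀ ℝ, Finsupp.linearCombination ℝ (fun v => (l' v : ℝ)) w =
      L (Finsupp.linearCombination ℝ homogenize w) := by
    intro w
    rw [Finsupp.apply_linearCombination]
    congr 2
    exact funext fun v => (hL v).symm
  have huU : ∀ w : (Fin n → ℤ) →₀ ℝ, Finsupp.linearCombination ℝ (fun v => (u' v : ℝ)) w =
      U (Finsupp.linearCombination ℝ homogenize w) := by
    intro w
    rw [Finsupp.apply_linearCombination]
    congr 2
    exact funext fun v => (hU v).symm
  have hlu : ∀ σ ∈ 𝓕, ∀ v ∈ σ, l' v ≤ u' v := by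
    intro σ hσ v hv
    have hvP : latticePoint v ∈ P := by
      rw [h.mem_iff]
      refine ⟨σ, hσ, Finsupp.single v 1, by simp, ?_, by simp [homogenize]⟩
      exact Finsupp.support_single_subset.trans (by simpa using hv)
    have := hLU _ hvP
    rw [← homogenize, hL, hU] at this
    exact_mod_cast this
  -- `L` and `U` differ at some vertex of each facet, as the facet spans the whole space.
  have hlt : ∀ σ ∈ 𝓕, ∃ v ∈ σ, l' v < u' v := by
    intro σ hσ
    by_contra! hcon
    obtain ⟨z, hz⟩ := hne
    obtain ⟨c, hc, hcz⟩ := h.exists_int σ hσ z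
    apply hz
    rw [← hcz, Finsupp.apply_linearCombination, Finsupp.apply_linearCombination]
    simp only [Finsupp.linearCombination_apply]
    refine Finset.sum_congr rfl fun v hv => ?_
    have := (hlu σ hσ v (hc hv)).antisymm (hcon v (hc hv))
    simp only [Function.comp_apply]
    rw [show l (1, v) = u (1, v) from this]
  refine ⟨?_, ?_, ?_, ?_⟩
  · intro F hF
    obtain ⟨σ, hσ, p, hp, j, hj, rfl⟩ := mem_chimneyFacets.1 hF
    rw [card_chimneyFacet, h.card_eq σ hσ]
  · intro F hF
    obtain ⟨σ, hσ, p, hp, j, hj, rfl⟩ := mem_chimneyFacets.1 hF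
    exact exists_int_chimneyFacet f l' u' hp j (h.exists_int σ hσ)
  · intro x
    constructor
    · rintro ⟨hxP, hxL, hxU⟩
      obtain ⟨σ, hσ, w, hw, hwσ, hwx⟩ := (h.mem_iff _).1 hxP
      rw [← hwx, ← hlL] at hxL
      rw [← hwx, ← huU] at hxU
      have hsum : ∀ a : (Fin n → ℤ) → ℝ,
          Finsupp.linearCombination ℝ a w = ∑ v ∈ σ, w v * a v := fun a => by
        rw [Finsupp.linearCombination_apply, Finsupp.sum_of_support_subset w hwσ _ (by simp)]
        rfl
      rw [hsum] at hxL hxU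
      obtain ⟨p, hp, hlup, h1, h2⟩ := exists_crossing f σ w
        (fun v => (l' v : ℝ)) (fun v => (u' v : ℝ)) (x (Fin.last n))
        (fun v hv => by exact_mod_cast hlu σ hσ v hv)
        (by obtain ⟨v, hv, hv'⟩ := hlt σ hσ; exact ⟨v, hv, by exact_mod_cast hv'⟩) hxL hxU
      have hlup' : l' p < u' p := by exact_mod_cast hlup
      -- The part of the height that comes from the vertices other than `p`; the value `0` at `p`
      -- itself plays no role.
      set B : ℝ := ∑ v ∈ σ.erase p, w v * (stair f l' u' p 0 v : ℝ) with hB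
      replace h1 : w p * l' p + B ≤ x (Fin.last n) := by
        refine le_of_eq_of_le ?_ h1
        rw [← Finset.add_sum_erase _ _ hp, if_neg (lt_irrefl _)]
        congr 1
        refine Finset.sum_congr rfl fun v hv => ?_
        rw [stair, if_neg (Finset.ne_of_mem_erase hv)]
        by_cases hvp : f v < f p
        · rw [if_pos hvp, if_pos hvp]
        · rw [if_neg hvp, if_neg hvp]
      replace h2 : x (Fin.last n) ≤ w p * u' p + B := by
        refine h2.trans_eq ?_
        rw [← Finset.add_sum_erase _ _ hp, if_pos le_rfl]
        congr 1
        refine Finset.sum_congr rfl fun v hv => ?_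
        have hne : f v ≠ f p := fun h => Finset.ne_of_mem_erase hv (hf h)
        rw [stair, if_neg (Finset.ne_of_mem_erase hv)]
        by_cases hvp : f v < f p
        · rw [if_pos hvp, if_pos hvp.le]
        · rw [if_neg hvp, if_neg fun h => hvp (lt_of_le_of_ne h hne)]
      obtain ⟨j, hj1, hj2, hj3, hj4⟩ := exists_int_step (w := w p) (t := x (Fin.last n) - B) hlup'
        (by linarith) (by linarith)
      have hD : Finsupp.linearCombination ℝ (fun v => (stair f l' u' p j v : ℝ)) w =
          w p * j + B := by
        rw [hsum, ← Finset.add_sum_erase _ _ hp, stair_self]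
        congr 1
        refine Finset.sum_congr rfl fun v hv => ?_
        rw [stair, stair, if_neg (Finset.ne_of_mem_erase hv), if_neg (Finset.ne_of_mem_erase hv)]
      set θ : ℝ := x (Fin.last n) - B - w p * j with hθ
      have hw1 : 0 ≤ w - Finsupp.single p θ := by
        intro v
        rcases eq_or_ne v p with rfl | hv
        · simp only [Finsupp.coe_zero, Pi.zero_apply, Finsupp.coe_sub, Pi.sub_apply,
            Finsupp.single_eq_same]
          linarith
        · simpa [Finsupp.single_eq_of_ne hv] using hw v
      have hw1σ : (w - Finsupp.single p θ).support ⊆ σ :=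
        Finsupp.support_sub.trans (Finset.union_subset hwσ
          (Finsupp.support_single_subset.trans (Finset.singleton_subset_iff.2 hp)))
      refine ⟨_, mem_chimneyFacets.2 ⟨σ, hσ, p, hp, j, ⟨hj1, hj2⟩, rfl⟩,
        (w - Finsupp.single p θ).mapDomain (graphPoint (stair f l' u' p j)) +
          Finsupp.single (Fin.snoc (α := fun _ => ℤ) p (j + 1)) θ, ?_, ?_, ?_⟩
      · exact add_nonneg (Finsupp.mapDomain_nonneg_real _ hw1)
          (Finsupp.single_nonneg.2 (by linarith))
      · refine Finsupp.support_add.trans (Finset.union_subset ?_ ?_)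
        · exact Finsupp.mapDomain_support.trans
            ((Finset.image_subset_image hw1σ).trans (Finset.subset_insert _ _))
        · exact Finsupp.support_single_subset.trans
            (Finset.singleton_subset_iff.2 (Finset.mem_insert_self _ _))
      · have e1 := linearCombination_homogenize_mapDomain_init
          ((w - Finsupp.single p θ).mapDomain (graphPoint (stair f l' u' p j)) +
            Finsupp.single (Fin.snoc (α := fun _ => ℤ) p (j + 1)) θ)
        have e2 := linearCombination_last
          ((w - Finsupp.single p θ).mapDomain (graphPoint (stair f l' u' p j)) +
            Finsupp.single (Fin.snoc (α := fun _ => ℤ) p (j + 1)) θ)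
        rw [mapDomain_init_lift, sub_add_cancel, hwx] at e1
        rw [linearCombination_last_lift, map_sub, hD, Finsupp.linearCombination_single,
          stair_self] at e2
        refine Prod.ext (congrArg Prod.fst e1).symm (funext fun i => ?_)
        induction i using Fin.lastCases with
        | last =>
          rw [← e2]
          push_cast
          simp only [smul_eq_mul]
          linear_combination hθ
        | cast i => exact (congrFun (congrArg Prod.snd e1) i).symm
    · rintro ⟨F, hF, W, hW, hWF, hWx⟩
      obtain ⟨σ, hσ, p, hp, j, ⟨hj1, hj2⟩, rfl⟩ := mem_chimneyFacets.1 hF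
      have e1 := linearCombination_homogenize_mapDomain_init W
      have e2 := linearCombination_last W
      rw [hWx] at e1 e2
      have hinit : ∀ q ∈ chimneyFacet f l' u' σ p j, Fin.init (α := fun _ => ℤ) q ∈ σ ∧
          l' (Fin.init q) ≤ q (Fin.last n) ∧ q (Fin.last n) ≤ u' (Fin.init q) := by
        intro q hq
        rcases Finset.mem_insert.1 hq with rfl | hq
        · rw [Fin.init_snoc (α := fun _ => ℤ), Fin.snoc_last (α := fun _ => ℤ)]
          exact ⟨hp, by omega, by omega⟩
        · obtain ⟨v, hv, rfl⟩ := Finset.mem_image.1 hq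
          rw [init_graphPoint, graphPoint_last]
          have := hlu σ hσ v hv
          refine ⟨hv, ?_⟩
          unfold stair
          split_ifs with _ hvp
          · exact ⟨this, le_rfl⟩
          · subst hvp
            exact ⟨hj1, hj2.le⟩
          · exact ⟨le_rfl, this⟩
      have hmono : ∀ a b : (Fin (n + 1) → ℤ) → ℝ, (∀ q ∈ chimneyFacet f l' u' σ p j, a q ≤ b q) →
          Finsupp.linearCombination ℝ a W ≤ Finsupp.linearCombination ℝ b W := by
        intro a b hab
        simp only [Finsupp.linearCombination_apply, Finsupp.sum]
        exact Finset.sum_le_sum fun q hq => mul_le_mul_of_nonneg_left (hab q (hWF hq)) (hW q)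
      refine ⟨(h.mem_iff _).2 ⟨σ, hσ, W.mapDomain (Fin.init (α := fun _ => ℤ)),
        Finsupp.mapDomain_nonneg_real _ hW, ?_, e1⟩, ?_, ?_⟩
      · refine Finsupp.mapDomain_support.trans fun v hv => ?_
        obtain ⟨q, hq, rfl⟩ := Finset.mem_image.1 hv
        exact (hinit q (hWF hq)).1
      · change L (1, Fin.init x) ≤ (1, x).2 (Fin.last n)
        rw [← e2]
        change L ((1, x).1, Fin.init (1, x).2) ≤ _
        rw [← e1, ← hlL, Finsupp.linearCombination_mapDomain]
        exact hmono _ _ fun q hq => Int.cast_le.2 (hinit q hq).2.1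
      · change (1, x).2 (Fin.last n) ≤ U (1, Fin.init x)
        rw [← e2]
        change _ ≤ U ((1, x).1, Fin.init (1, x).2)
        rw [← e1, ← huU, Finsupp.linearCombination_mapDomain]
        exact hmono _ _ fun q hq => Int.cast_le.2 (hinit q hq).2.2
  · intro F hF F' hF' W W' hW hW' hWF hWF' heq
    obtain ⟨σ, hσ, p, hp, j, ⟨hj1, hj2⟩, rfl⟩ := mem_chimneyFacets.1 hF
    obtain ⟨σ', hσ', p', hp', j', ⟨hj1', hj2'⟩, rfl⟩ := mem_chimneyFacets.1 hF'
    obtain ⟨w, θ, hw, hθ, hwσ, rfl⟩ := exists_decomposition_of_support_subset hW hWF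
    obtain ⟨w', θ', hw', hθ', hwσ', rfl⟩ := exists_decomposition_of_support_subset hW' hWF'
    have hsub : ∀ {τ : Finset (Fin n → ℤ)} {v : (Fin n → ℤ) →₀ ℝ} {q : Fin n → ℤ} {t : ℝ},
        v.support ⊆ τ → q ∈ τ → (v + Finsupp.single q t).support ⊆ τ := fun hv hq =>
      Finsupp.support_add.trans (Finset.union_subset hv
        (Finsupp.support_single_subset.trans (Finset.singleton_subset_iff.2 hq)))
    have hbase : w + Finsupp.single p θ = w' + Finsupp.single p' θ' := by
      refine h.unique σ hσ σ' hσ' _ _ (add_nonneg hw (Finsupp.single_nonneg.2 hθ))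
        (add_nonneg hw' (Finsupp.single_nonneg.2 hθ')) (hsub hwσ hp) (hsub hwσ' hp') ?_
      rw [← mapDomain_init_lift (stair f l' u' p j) w p (j + 1) θ,
        ← mapDomain_init_lift (stair f l' u' p' j') w' p' (j' + 1) θ',
        linearCombination_homogenize_mapDomain_init, linearCombination_homogenize_mapDomain_init,
        heq]
    have hheight := linearCombination_last (w.mapDomain (graphPoint (stair f l' u' p j)) +
      Finsupp.single (Fin.snoc (α := fun _ => ℤ) p (j + 1)) θ)
    rw [heq, ← linearCombination_last, linearCombination_last_lift,
      linearCombination_last_lift] at hheight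
    have hcomp : ∀ {σ : Finset (Fin n → ℤ)} {w w' : (Fin n → ℤ) →₀ ℝ} {p p' : Fin n → ℤ}
        {j j' : ℤ} {θ θ' : ℝ}, σ ∈ 𝓕 → w.support ⊆ σ → 0 ≤ w → 0 ≤ θ → 0 ≤ θ' →
        j < u' p → l' p' ≤ j' → (f p < f p' ∨ p = p' ∧ j < j') →
        w + Finsupp.single p θ = w' + Finsupp.single p' θ' →
        Finsupp.linearCombination ℝ (fun v => (stair f l' u' p j v : ℝ)) w + θ * (j + 1 : ℤ) =
          Finsupp.linearCombination ℝ (fun v => (stair f l' u' p' j' v : ℝ)) w' +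
            θ' * (j' + 1 : ℤ) →
        w.mapDomain (graphPoint (stair f l' u' p j)) +
            Finsupp.single (Fin.snoc (α := fun _ => ℤ) p (j + 1)) θ =
          w'.mapDomain (graphPoint (stair f l' u' p' j')) +
            Finsupp.single (Fin.snoc (α := fun _ => ℤ) p' (j' + 1)) θ' := by
      intro σ w w' p p' j j' θ θ' hσ hwσ hw hθ hθ' hj hj' hlex hbase hheight
      have := lift_eq_lift_of_le (a := stair f l' u' p j) (b := stair f l' u' p' j') hw hθ hθ'
        (fun v hv => stair_le_stair hj hj' hlex (hlu σ hσ v (hwσ hv)))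
        (by rw [stair_self]; exact add_one_le_stair hj hlex) hbase
        (by rw [stair_self, stair_self]; exact hheight)
      simpa only [stair_self] using this
    rcases lt_trichotomy (f p) (f p') with hlt' | heq' | hlt'
    · exact hcomp hσ hwσ hw hθ hθ' hj2 hj1' (Or.inl hlt') hbase hheight
    · obtain rfl : p = p' := hf heq'
      rcases lt_trichotomy j j' with hjj | rfl | hjj
      · exact hcomp hσ hwσ hw hθ hθ' hj2 hj1' (Or.inr ⟨rfl, hjj⟩) hbase hheight
      · -- In the same step, the height determines the weight of the apex.
        have hb := congrArg
          (Finsupp.linearCombination ℝ (fun v => (stair f l' u' p j v : ℝ))) hbase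
        simp only [map_add, Finsupp.linearCombination_single, smul_eq_mul, stair_self] at hb
        push_cast at hheight
        obtain rfl : θ = θ' := by linarith
        rw [add_right_cancel hbase]
      · exact (hcomp hσ' hwσ' hw' hθ' hθ hj2' hj1 (Or.inr ⟨rfl, hjj⟩) hbase.symm hheight.symm).symm
    · exact (hcomp hσ' hwσ' hw' hθ' hθ hj2' hj1 (Or.inl hlt') hbase.symm hheight.symm).symm

end Chimney

/-! ### Lecture hall polytopes -/

theorem Fin.monotone_iff_init {α : Type*} [Preorder α] {m : ℕ} (a : Fin (m + 2) → α) :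
    Monotone a ↔ Monotone (fun i : Fin (m + 1) => a i.castSucc) ∧
      a (Fin.last m).castSucc ≤ a (Fin.last (m + 1)) := by
  rw [Fin.monotone_iff_le_succ, Fin.monotone_iff_le_succ, Fin.forall_fin_succ']
  simp only [← Fin.castSucc_succ, Fin.succ_last]

/-- The lecture hall polytope of a sequence with `s_{m+2} = k s_{m+1}` is the chimney over the one
of the truncated sequence, between `k x_{m+1}` and `s_{m+2}`. -/
theorem mem_lectureHallPolytope_iff_init {m k : ℕ} {s : Fin (m + 2) → ℕ} (hpos : ∀ i, 0 < s i)
    (hk : s (Fin.last (m + 1)) = k * s (Fin.last m).castSucc) (x : Fin (m + 2) → ℝ) :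
    x ∈ lectureHallPolytope s ↔
      Fin.init x ∈ lectureHallPolytope (Fin.init s) ∧
        (k : ℝ) * x (Fin.last m).castSucc ≤ x (Fin.last (m + 1)) ∧
        x (Fin.last (m + 1)) ≤ s (Fin.last (m + 1)) := by
  have hs : (0 : ℝ) < s (Fin.last m).castSucc := by exact_mod_cast hpos _
  have hs' : (0 : ℝ) < s (Fin.last (m + 1)) := by exact_mod_cast hpos _
  have hk' : (s (Fin.last (m + 1)) : ℝ) = k * s (Fin.last m).castSucc := by exact_mod_cast hk
  have hslope : (k : ℝ) * x (Fin.last m).castSucc ≤ x (Fin.last (m + 1)) ↔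
      x (Fin.last m).castSucc / s (Fin.last m).castSucc ≤
        x (Fin.last (m + 1)) / s (Fin.last (m + 1)) := by
    rw [div_le_div_iff₀ hs hs', hk', ← mul_le_mul_iff_left₀ hs]
    ring_nf
  have htop : x (Fin.last (m + 1)) ≤ s (Fin.last (m + 1)) ↔
      x (Fin.last (m + 1)) / s (Fin.last (m + 1)) ≤ 1 := by rw [div_le_one hs']
  rw [hslope, htop]
  simp only [lectureHallPolytope, Set.mem_ofPred_eq, Fin.monotone_iff_init, Fin.init]
  constructor
  · rintro ⟨h0, ⟨hm, hl⟩, h1⟩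
    exact ⟨⟨fun i => h0 _, hm, fun i => h1 _⟩, hl, h1 _⟩
  · rintro ⟨⟨h0, hm, h1⟩, hl, hu⟩
    refine ⟨Fin.forall_fin_succ'.2 ⟨h0, (h0 (Fin.last m)).trans hl⟩, ⟨hm, hl⟩,
      Fin.forall_fin_succ'.2 ⟨h1, hu⟩⟩

theorem mem_lectureHallPolytope_one_iff {s : Fin 1 → ℕ} (hpos : ∀ i, 0 < s i) (x : Fin 1 → ℝ) :
    x ∈ lectureHallPolytope s ↔ 0 ≤ x 0 ∧ x 0 ≤ s 0 := by
  have hs : (0 : ℝ) < s 0 := by exact_mod_cast hpos 0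
  simp [lectureHallPolytope, Subsingleton.monotone, div_le_one hs, le_div_iff₀ hs]

theorem isUnimodularFacetFamily_zero (s : Fin 0 → ℕ) :
    IsUnimodularFacetFamily {{0}} (lectureHallPolytope s) where
  card_eq := by simp
  exists_int F hF z := by
    obtain rfl := Finset.mem_singleton.1 hF
    exact ⟨Finsupp.single 0 1, Finsupp.support_single_subset, by simp [Subsingleton.elim z 0]⟩
  mem_iff x := by
    refine iff_of_true ⟨nofun, Subsingleton.monotone _, nofun⟩
      ⟨{0}, Finset.mem_singleton_self _, Finsupp.single 0 1, by simp,
        Finsupp.support_single_subset, ?_⟩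
    simp [homogenize, Subsingleton.elim x (latticePoint 0)]
  unique F hF F' hF' W W' _ _ hW hW' heq := by
    have key : ∀ V : (Fin 0 → ℤ) →₀ ℝ, (Finsupp.linearCombination ℝ homogenize V).1 = V 0 := by
      intro V
      rw [Finsupp.linearCombination_apply, Finsupp.sum_of_support_subset (s := {0}) _ _ _ (by simp)]
      · simp [homogenize]
      · intro v _
        simpa using Subsingleton.elim v 0
    refine Finsupp.ext fun v => ?_
    rw [Subsingleton.elim v 0, ← key, ← key, heq]

theorem exists_isUnimodularFacetFamily_lectureHallPolytope (d : ℕ) (s : Fin d → ℕ)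
    (hpos : ∀ i, 0 < s i)
    (hdiv : ∀ (i : ℕ) (hi : i + 1 < d), ∃ k : ℕ,
      s ⟨i + 1, hi⟩ = k * s ⟨i, Nat.lt_of_succ_lt hi⟩) :
    ∃ 𝓕, IsUnimodularFacetFamily 𝓕 (lectureHallPolytope s) := by
  induction d with
  | zero => exact ⟨_, isUnimodularFacetFamily_zero s⟩
  | succ n ih =>
    obtain ⟨𝓕, h𝓕⟩ := ih (Fin.init s) (fun i => hpos _) (fun i hi => hdiv i (by omega))
    -- It remains to find the integral linear function that bounds the last coordinate from below.
    suffices hlin : ∃ (l : ℤ × (Fin n → ℤ) →ₗ[ℤ] ℤ) (L : ℝ × (Fin n → ℝ) →ₗ[ℝ] ℝ),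
        (∀ v, L (homogenize v) = l (1, v)) ∧ l (1, 0) = 0 ∧
        (∀ x ∈ lectureHallPolytope (Fin.init s), L (1, x) ≤ s (Fin.last n)) ∧
        ∀ x, x ∈ lectureHallPolytope s ↔ Fin.init x ∈ lectureHallPolytope (Fin.init s) ∧
          L (1, Fin.init x) ≤ x (Fin.last n) ∧ x (Fin.last n) ≤ s (Fin.last n) by
      obtain ⟨l, L, hL, hl0, hLs, hmem⟩ := hlin
      have hchim := h𝓕.chimney (f := (toLex : (Fin n → ℤ) → Lex (Fin n → ℤ))) toLex.injective l
        ((s (Fin.last n) : ℤ) • LinearMap.fst ℤ ℤ (Fin n → ℤ)) L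
        ((s (Fin.last n) : ℝ) • LinearMap.fst ℝ ℝ (Fin n → ℝ)) hL (by simp [homogenize])
        (by simpa using hLs) ⟨0, by simp [hl0, eq_comm, (hpos (Fin.last n)).ne']⟩
      have hset : {x : Fin (n + 1) → ℝ | Fin.init x ∈ lectureHallPolytope (Fin.init s) ∧
          L (1, Fin.init x) ≤ x (Fin.last n) ∧ x (Fin.last n) ≤
            ((s (Fin.last n) : ℝ) • LinearMap.fst ℝ ℝ (Fin n → ℝ)) (1, Fin.init x)} =
          lectureHallPolytope s := Set.ext fun x => by rw [hmem]; simp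
      exact ⟨_, hset ▸ hchim⟩
    cases n with
    | zero =>
      refine ⟨0, 0, by simp, by simp, by simp, fun x => ?_⟩
      rw [mem_lectureHallPolytope_one_iff hpos]
      have : Fin.init x ∈ lectureHallPolytope (Fin.init s) :=
        ⟨nofun, Subsingleton.monotone _, nofun⟩
      simp [this]
    | succ m =>
      obtain ⟨k, hk⟩ := hdiv m (by omega)
      refine ⟨(k : ℤ) • LinearMap.proj (Fin.last m) ∘ₗ LinearMap.snd ℤ ℤ (Fin (m + 1) → ℤ),
        (k : ℝ) • LinearMap.proj (Fin.last m) ∘ₗ LinearMap.snd ℝ ℝ (Fin (m + 1) → ℝ),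
        by simp [homogenize, latticePoint], by simp, ?_, ?_⟩
      · intro x hx
        have hs : (0 : ℝ) < s (Fin.last m).castSucc := by exact_mod_cast hpos _
        have h1 : x (Fin.last m) ≤ s (Fin.last m).castSucc := (div_le_one hs).1 (hx.2.2 _)
        have hk' : (s (Fin.last (m + 1)) : ℝ) = k * s (Fin.last m).castSucc := by
          exact_mod_cast hk
        rw [hk']
        simpa using mul_le_mul_of_nonneg_left h1 (Nat.cast_nonneg k)
      · intro x
        rw [mem_lectureHallPolytope_iff_init hpos hk]
        simp [Fin.init]

theorem mainTheorem2 (d : ℕ) (s : Fin d → ℕ) (hpos : ∀ i, 0 < s i) (hmono : Monotone s)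
    (hdiv : ∀ (i : ℕ) (hi : i + 1 < d), ∃ k : ℕ, 0 < k ∧
      s ⟨i + 1, hi⟩ = k * s ⟨i, Nat.lt_of_succ_lt hi⟩) :
    AdmitsUnimodularTriangulation (lectureHallPolytope s) := by
  obtain ⟨𝓕, h⟩ := exists_isUnimodularFacetFamily_lectureHallPolytope d s hpos
    fun i hi => (hdiv i hi).imp fun k hk => hk.2
  exact h.admitsUnimodularTriangulation
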